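/- **Circuit model (Thompson).** A circuit is laid out on the planar grid of unit squares; each square is empty, contains a computational node, or contains wiring of unit width (one wire joining two of its sides, or two wires crossing at a right angle). Wires join nodes, are bidirectional, and carry one bit in each direction per clock cycle. Each node has at most four wires and a constant number $m$ of bits of memory; in every clock cycle it computes a fixed function of the bits arriving on its wires, its memory, and the channel symbol injected into it in that cycle (if any). The *area* $A$ is the number of nonempty squares, $T$ is the number of clock cycles, and the *Thompson energy* is $E=AT$. An $(n,k)$-decoder is such a circuit that receives the $n$ channel output symbols, each exactly once, and puts out the $k$ decoded bits, at nodes and clock cycles fixed in advance, with at most one symbol injected into and at most one bit put out by any node in any clock cycle. A node that puts out at least one bit is an *output node*. **Decoding schemes.** A decoding scheme is an infinite sequence of decoders with block lengths $n_1<n_2<\cdots$ and numbers of decoded bits $k(n_1),k(n_2),\ldots$, together with encoding functions $\{0,1\}^{k(n_i)}\to\{0,1\}^{n_i}$; the number $m$ of memory bits per node is the same for all circuits of the scheme. The block error probability $P_{\mathrm e}(n)$ is the probability that the decoder output differs from the message, for a message of $k(n)$ independent fair bits sent through $n$ uses of a binary erasure channel with erasure probability $\epsilon$. For $f:\mathbb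 N\to\mathbb R$, the scheme is an *$f(n)$-decoding scheme* if $P_{\mathrm e}(n)<f(n)$ for all sufficiently large block lengths $n$ of the scheme. It is *serial* if the number of output nodes is the same constant for all its decoders. **Theorem.** Let $0<\epsilon\le 1$ and $f:\mathbb N\to\mathbb R$. Every serial $f(n)$-decoding scheme whose rate $k(n)/n$ is eventually bounded below by a positive constant (for example, with positive asymptotic rate) has Thompson energy $E(n)=\Omega\bigl(n\,|\ln f(n)|\bigr)$, where $|\ln f(n)|$ stands for $-\ln f(n)=\ln\frac1{f(n)}$; that is, there is a constant $c>0$ such that $$E(n)\ \ge\ c\,n\,\ln\frac{1}{f(n)}$$ for all sufficiently large block lengths $n$ of the scheme. -/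

import Mathlib

namespace Thompson

/-- The four sides of a unit grid square, also used as the four directions of travel. -/
inductive Dir
  | north
  | south
  | east
  | west
  deriving DecidableEq

instance : Fintype Dir where
  elems := {.north, .south, .east, .west}
  complete d := by cases d <;> decide

/-- The opposite side. -/
def Dir.opp : Dir → Dir
  | .north => .south
  | .south => .north
  | .east => .west
  | .west => .east

/-- The unit displacement in a given direction. -/
def Dir.vec : Dir → ℤ × ℤ
  | .north => (0, 1)
  | .south => (0, -1)
  | .east => (1, 0)
  | .west => (-1, 0)

/-- What a wiring square holds: one wire (straight or bent) that joins two distinct sides, or two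
wires that cross at a right angle. -/
inductive Track
  | wire (p q : Dir) (h : p ≠ q)
  | crossing

/-- A signal travelling in direction `d` enters a square by its side `d.opp`; `thru` is the direction
in which the wire carries it out of the square (`none` if no wire starts at the side of entry). -/
def Track.thru : Track → Dir → Option Dir
  | .wire p q _, d => if d.opp = p then some q else if d.opp = q then some p else none
  | .crossing, d => some d

/-- A circuit layout on the planar grid of unit squares. Every square is empty, holds one
computational node, or holds wiring; wires have unit width. The values of `track` outside of
`wires` are irrelevant. -/
structure Layout where
  nodes : Finset (ℤ × ℤ)
  wires : Finset (ℤ × ℤ)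
  disj : Disjoint nodes wires
  track : ℤ × ℤ → Track

namespace Layout

/-- The computational nodes of a layout. -/
abbrev Node (L : Layout) : Type := {s : ℤ × ℤ // s ∈ L.nodes}

/-- The area occupied by the circuit: the number of nonempty unit squares. -/
def area (L : Layout) : ℕ := L.nodes.card + L.wires.card

/-- Leave the square `s` in direction `d` and follow the wire, for at most `fuel` squares, up to the
node at its other end; the result is that node and the port (side) at which the wire arrives. -/
def trace (L : Layout) : ℕ → ℤ × ℤ → Dir → Option (L.Node × Dir)
  | 0, _, _ => none
  | fuel + 1, s, d =>
    if h : s + d.vec ∈ L.nodes then some (⟨s + d.vec, h⟩, d.opp)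
    else if s + d.vec ∈ L.wires then
      match (L.track (s + d.vec)).thru d with
      | none => none
      | some d' => L.trace fuel (s + d.vec) d'
    else none

/-- The node and port at the other end of the wire attached to port `d` of the node `v`, if there is
one. A wire visits no pair (square, direction) twice, so the bound `4 * area + 1` on its length is
no restriction. -/
def peer (L : Layout) (v : L.Node) (d : Dir) : Option (L.Node × Dir) :=
  L.trace (4 * L.area + 1) v.1 d

end Layout

/-- The alphabet at the output of the binary erasure channel; `none` is an erasure. -/
abbrev Symbol : Type := Option Bool

/-- The function computed by a node with `m` bits of memory in one clock cycle. Arguments: the bits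
arriving on its (at most four) wires, its memory, and the channel symbol injected in this cycle
(`none` if there is none). Values: the bits sent on its wires, the new memory, and the bit put out,
which counts only at an output node in a cycle in which it is scheduled to put out a bit. -/
abbrev NodeOp (m : ℕ) : Type :=
  (Dir → Bool) → (Fin m → Bool) → Option Symbol → (Dir → Bool) × (Fin m → Bool) × Bool

/-- A synchronous circuit in the Thompson model, with `n` input symbols and `k` output bits, run for
`T` clock cycles. Wires are bidirectional and carry one bit in each direction per cycle, and each
node has `m` bits of memory. Each input is injected exactly once and each output bit is put out at a
specified node and cycle, at most one input and at most one output per node and cycle. -/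
structure Circuit (m n k : ℕ) extends Layout where
  /-- number of clock cycles -/
  T : ℕ
  op : toLayout.Node → NodeOp m
  /-- initial bits on the wires and in the memories -/
  init : toLayout.Node → (Dir → Bool) × (Fin m → Bool)
  inNode : Fin n → toLayout.Node
  inTime : Fin n → Fin T
  in_inj : Function.Injective fun a => (inNode a, inTime a)
  outNode : Fin k → toLayout.Node
  outTime : Fin k → Fin T
  out_inj : Function.Injective fun b => (outNode b, outTime b)

namespace Circuit

variable {m n k : ℕ}

/-- The state of a circuit between two cycles: for each node the bits it has last sent on its wires,
and the content of its memory. -/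
abbrev State (C : Circuit m n k) : Type := C.Node → (Dir → Bool) × (Fin m → Bool)

/-- The bit arriving at port `d` of node `v`; it is `0` if no node is attached there. -/
def incoming (C : Circuit m n k) (σ : C.State) (v : C.Node) (d : Dir) : Bool :=
  match C.peer v d with
  | none => false
  | some (w, e) => (σ w).1 e

/-- The symbol of `y` injected into node `v` in cycle `t`, if any. -/
def injected (C : Circuit m n k) (y : Fin n → Symbol) (v : C.Node) (t : ℕ) : Option Symbol :=
  ((List.finRange n).find? fun a => C.inNode a = v ∧ (C.inTime a : ℕ) = t).map y

/-- What node `v` computes in cycle `t` from the state `σ`. -/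
def fire (C : Circuit m n k) (y : Fin n → Symbol) (σ : C.State) (t : ℕ) (v : C.Node) :
    (Dir → Bool) × (Fin m → Bool) × Bool :=
  C.op v (C.incoming σ v) (σ v).2 (C.injected y v t)

/-- The state after `t` cycles on input `y`. -/
def stateAt (C : Circuit m n k) (y : Fin n → Symbol) : ℕ → C.State
  | 0 => C.init
  | t + 1 => fun v =>
    ((C.fire y (C.stateAt y t) t v).1, (C.fire y (C.stateAt y t) t v).2.1)

/-- The decoding function computed by the circuit. -/
def decode (C : Circuit m n k) (y : Fin n → Symbol) : Fin k → Bool := fun b =>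
  (C.fire y (C.stateAt y (C.outTime b)) (C.outTime b) (C.outNode b)).2.2

/-- The number of output nodes: nodes that put out at least one bit. -/
def numOutputNodes (C : Circuit m n k) : ℕ := (Finset.univ.image C.outNode).card

/-- The Thompson energy: area times number of clock cycles. -/
def energy (C : Circuit m n k) : ℕ := C.area * C.T

end Circuit

/-- Transition probabilities of the binary erasure channel with erasure probability `ε`. -/
noncomputable def bec (ε : ℝ) (b : Bool) : Symbol → ℝ
  | none => ε
  | some b' => if b' = b then 1 - ε else 0

/-- The probability that a uniformly distributed `k`-bit message, encoded by `enc` and sent through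
`n` independent uses of the erasure channel, is decoded incorrectly by `dec`. -/
noncomputable def blockErrorProb (ε : ℝ) {n k : ℕ} (enc : (Fin k → Bool) → (Fin n → Bool))
    (dec : (Fin n → Symbol) → (Fin k → Bool)) : ℝ :=
  ∑ x : Fin k → Bool, (1 / 2 : ℝ) ^ k *
    ∑ y : Fin n → Symbol, (∏ a, bec ε (enc x a) (y a)) * if dec y = x then 0 else 1

/-- A decoding scheme: a sequence of codes with strictly increasing block lengths together with
decoder circuits, whose nodes all have `m` bits of memory. -/
structure DecodingScheme (m : ℕ) where
  /-- block lengths -/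
  n : ℕ → ℕ
  n_strictMono : StrictMono n
  /-- numbers of bits decoded -/
  k : ℕ → ℕ
  enc : ∀ i, (Fin (k i) → Bool) → (Fin (n i) → Bool)
  dec : ∀ i, Circuit m (n i) (k i)

namespace DecodingScheme

variable {m : ℕ}

/-- The block error probability of the `i`-th decoder over the erasure channel. -/
noncomputable def errorProb (S : DecodingScheme m) (ε : ℝ) (i : ℕ) : ℝ :=
  blockErrorProb ε (S.enc i) (S.dec i).decode

/-- The block error probability is less than `f n` at all sufficiently large block lengths `n`. -/
def IsFDecoding (S : DecodingScheme m) (ε : ℝ) (f : ℕ → ℝ) : Prop :=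
  ∀ᶠ i in Filter.atTop, S.errorProb ε i < f (S.n i)

/-- Serial: the number of output nodes is constant. -/
def IsSerial (S : DecodingScheme m) : Prop :=
  ∃ j : ℕ, ∀ i, (S.dec i).numOutputNodes = j

/-- The rate `k / n` is eventually bounded below by a positive constant; this holds in particular
whenever the rate converges to a positive limit. -/
def HasPositiveRate (S : DecodingScheme m) : Prop :=
  ∃ ρ : ℝ, 0 < ρ ∧ ∀ᶠ i in Filter.atTop, ρ * (S.n i : ℝ) ≤ (S.k i : ℝ)

end DecodingScheme

end Thompson

/-!
Let `J` be the number of output nodes and `A` the area. The state of a decoder between two cycles is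
one of `2 ^ O(A)`, and at most `A` bits are put out in one cycle. Cutting the time axis whenever
another `O(A)` bits have been put out gives about `k / A` windows, so some window takes in only
`O(A n / k)` channel symbols although it puts out more bits than a state can hold. With
probability `ε ^ O(A n / k)` all these symbols are erased; then the bits put out in the window depend
on the state at its beginning only, hence are wrong for at least half of the messages. Therefore
`-log P_e = O(A n / k)`, that is `A = Ω(-log P_e)` at positive rate, while `J T ≥ k = Ω(n)` because
each output node puts out at most one bit per cycle.
-/

namespace Thompson

open Finset

section Counting

variable {ι α : Type*} [Fintype ι] [Fintype α]

lemma card_filter_restrict_mem [DecidableEq ι] [DecidableEq α] (W : Finset ι)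
    (G : Finset (W → α)) :
    #{x : ι → α | W.restrict x ∈ G} = #G * Fintype.card α ^ #Wᶜ := by
  rw [Finset.card_equiv (Equiv.piEquivPiSubtypeProd (· ∈ W) fun _ => α)
    (t := G ×ˢ univ) fun x => by
      rw [Finset.mem_filter_univ, Finset.mem_product]
      exact (and_iff_left (Finset.mem_univ _)).symm]
  simp [Finset.card_product, Fintype.card_subtype, Finset.compl_eq_univ_sdiff,
    Finset.filter_notMem_eq_sdiff]

end Counting

lemma card_image_le_card_image_of_factors {α β γ : Type*} [DecidableEq β] [DecidableEq γ]
    {s : Finset α} {f : α → β} {g : α → γ}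
    (h : ∀ a ∈ s, ∀ b ∈ s, g a = g b → f a = f b) : #(s.image f) ≤ #(s.image g) := by
  refine Finset.card_le_card_of_forall_subsingleton (fun x y => ∃ a ∈ s, f a = x ∧ g a = y) ?_ ?_
  · intro x hx
    obtain ⟨a, ha, rfl⟩ := Finset.mem_image.1 hx
    exact ⟨g a, Finset.mem_image_of_mem g ha, a, ha, rfl, rfl⟩
  · rintro y - _ ⟨-, a, ha, rfl, rfl⟩ _ ⟨-, b, hb, rfl, hba⟩
    exact h a ha b hb hba.symm

section Windows

lemma exists_le_and_le_add_of_step {O : ℕ → ℕ} {J a T : ℕ} (hzero : O 0 ≤ a + J)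
    (hstep : ∀ t, O (t + 1) ≤ O t + J) (ha : a ≤ O T) : ∃ t ≤ T, a ≤ O t ∧ O t ≤ a + J := by
  induction T with
  | zero => exact ⟨0, le_rfl, ha, hzero⟩
  | succ T ih =>
    rcases le_or_gt a (O T) with hle | hlt
    · obtain ⟨t, ht, h⟩ := ih hle
      exact ⟨t, ht.trans T.le_succ, h⟩
    · exact ⟨T + 1, le_rfl, ha, (hstep T).trans (by gcongr)⟩

lemma exists_mul_sub_le {R : Type*} [CommRing R] [LinearOrder R] [IsStrictOrderedRing R]
    (u : ℕ → R) {Q : ℕ} (hQ : 0 < Q) : ∃ q < Q, Q * (u (q + 1) - u q) ≤ u Q - u 0 := by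
  have hsum : ∑ q ∈ range Q, Q * (u (q + 1) - u q) ≤ ∑ _q ∈ range Q, (u Q - u 0) := by
    rw [← Finset.mul_sum, Finset.sum_range_sub, Finset.sum_const, Finset.card_range, nsmul_eq_mul]
  obtain ⟨q, hq, hle⟩ :=
    Finset.exists_le_of_sum_le (Finset.nonempty_range_iff.2 hQ.ne') hsum
  exact ⟨q, Finset.mem_range.1 hq, hle⟩

lemma exists_add_le_and_sub_mul_le {R : Type*} [CommRing R] [LinearOrder R] [IsStrictOrderedRing R]
    {O : ℕ → ℕ} {I : ℕ → R} {J M T : ℕ} (hI : Monotone I) (hM : 0 < M) (hzero : O 0 = 0)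
    (hstep : ∀ t, O (t + 1) ≤ O t + J) (hT : M + J ≤ O T) :
    ∃ s t, O s + M ≤ O t ∧ (I t - I s) * O T ≤ 2 * (M + J) * (I T - I 0) := by
  set Q := O T / (M + J)
  have hQ : 0 < Q := Nat.div_pos hT (by omega)
  have hlevel : ∀ q ≤ Q, q * (M + J) ≤ O T := fun q hq =>
    (Nat.mul_le_mul_right _ hq).trans (Nat.div_mul_le_self _ _)
  choose! time htime_le hle_time htime using fun q (hq : q ≤ Q) =>
    exists_le_and_le_add_of_step (by omega) hstep (hlevel q hq)
  obtain ⟨q, hq, hshare⟩ := exists_mul_sub_le (fun q => I (time q)) hQ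
  have hgrowth : O (time q) + M ≤ O (time (q + 1)) := by
    linarith [htime q hq.le, hle_time (q + 1) hq]
  refine ⟨time q, time (q + 1), hgrowth, ?_⟩
  have htotal : I (time Q) - I (time 0) ≤ I T - I 0 :=
    sub_le_sub (hI (htime_le Q le_rfl)) (hI (Nat.zero_le _))
  have htotal_nonneg : 0 ≤ I T - I 0 := sub_nonneg.2 (hI (Nat.zero_le _))
  have hOT : O T ≤ 2 * (M + J) * Q := by
    have hlt : O T < Q * (M + J) + (M + J) := Nat.lt_div_mul_add (by omega)
    nlinarith
  rcases le_total (I (time (q + 1)) - I (time q)) 0 with hneg | hpos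
  · exact (mul_nonpos_of_nonpos_of_nonneg hneg (Nat.cast_nonneg _)).trans (by positivity)
  · calc (I (time (q + 1)) - I (time q)) * O T
        ≤ (I (time (q + 1)) - I (time q)) * (2 * (M + J) * Q) := by gcongr; exact_mod_cast hOT
      _ = 2 * (M + J) * (Q * (I (time (q + 1)) - I (time q))) := by ring
      _ ≤ 2 * (M + J) * (I T - I 0) := by gcongr; exact hshare.trans htotal

/-- The events, with times of occurrence `τ`, that take place in the cycles `s, …, t - 1`. -/
def eventsDuring {ι : Type*} [Fintype ι] (τ : ι → ℕ) (s t : ℕ) : Finset ι :=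
  {a | s ≤ τ a ∧ τ a < t}

variable {ι κ : Type*} [Fintype ι] [Fintype κ]

@[simp]
lemma mem_eventsDuring {τ : ι → ℕ} {s t : ℕ} {a : ι} :
    a ∈ eventsDuring τ s t ↔ s ≤ τ a ∧ τ a < t := by
  simp [eventsDuring]

lemma eventsDuring_zero_of_forall_lt {τ : ι → ℕ} {T : ℕ} (hT : ∀ a, τ a < T) :
    eventsDuring τ 0 T = univ := by
  ext a
  simp [hT a]

lemma card_eventsDuring_add_card_eventsDuring (τ : ι → ℕ) {r s t : ℕ} (hrs : r ≤ s)
    (hst : s ≤ t) :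
    #(eventsDuring τ r s) + #(eventsDuring τ s t) = #(eventsDuring τ r t) := by
  classical
  rw [← Finset.card_union_of_disjoint]
  · congr 1
    ext a
    simp only [Finset.mem_union, mem_eventsDuring]
    omega
  · rw [Finset.disjoint_left]
    intro a
    simp only [mem_eventsDuring]
    omega

lemma monotone_card_eventsDuring (τ : ι → ℕ) (s : ℕ) :
    Monotone fun t => #(eventsDuring τ s t) := fun t u htu =>
  Finset.card_le_card fun a ha => by
    rw [mem_eventsDuring] at ha ⊢
    exact ⟨ha.1, ha.2.trans_le htu⟩

lemma card_eventsDuring_succ_le {τ : ι → ℕ} {J : ℕ} (hJ : ∀ t, #{a | τ a = t} ≤ J) (t : ℕ) :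
    #(eventsDuring τ 0 (t + 1)) ≤ #(eventsDuring τ 0 t) + J := by
  have hsingle : eventsDuring τ t (t + 1) = ({a | τ a = t} : Finset ι) := by
    ext a
    simp only [mem_eventsDuring, Finset.mem_filter_univ]
    omega
  rw [← card_eventsDuring_add_card_eventsDuring τ t.zero_le t.le_succ, hsingle]
  exact Nat.add_le_add_left (hJ t) _

lemma exists_card_eventsDuring_mul_card_le (τ : ι → ℕ) {σ : κ → ℕ} {J M : ℕ} (hM : 0 < M)
    (hJ : ∀ t, #{b | σ b = t} ≤ J) (hcard : M + J ≤ Fintype.card κ) :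
    ∃ s t, M ≤ #(eventsDuring σ s t) ∧
      #(eventsDuring τ s t) * Fintype.card κ ≤ 2 * (M + J) * Fintype.card ι := by
  obtain ⟨T, hT⟩ : ∃ T, ∀ b, σ b < T :=
    ⟨univ.sup σ + 1, fun b => Nat.lt_succ_of_le (Finset.le_sup (Finset.mem_univ b))⟩
  have hσT : #(eventsDuring σ 0 T) = Fintype.card κ := by
    rw [eventsDuring_zero_of_forall_lt hT, Finset.card_univ]
  obtain ⟨s, t, hgrowth, hshare⟩ := exists_add_le_and_sub_mul_le
    (O := fun t => #(eventsDuring σ 0 t)) (I := fun t => (#(eventsDuring τ 0 t) : ℤ)) (T := T)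
    (Nat.mono_cast.comp (monotone_card_eventsDuring τ 0)) hM (by simp [eventsDuring])
    (card_eventsDuring_succ_le hJ) (by rwa [hσT])
  have hst : s ≤ t := ((monotone_card_eventsDuring σ 0).reflect_lt (by grind)).le
  have hσ := card_eventsDuring_add_card_eventsDuring σ s.zero_le hst
  have hτ := card_eventsDuring_add_card_eventsDuring τ s.zero_le hst
  refine ⟨s, t, by omega, ?_⟩
  rw [← hτ, hσT, Nat.cast_add, add_sub_cancel_left] at hshare
  zify
  refine hshare.trans ?_
  gcongr
  exact (sub_le_self _ (Nat.cast_nonneg _)).trans (by exact_mod_cast Finset.card_le_univ _)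

end Windows

section ErrorProbability

lemma bec_nonneg {ε : ℝ} (hε0 : 0 ≤ ε) (hε1 : ε ≤ 1) (b : Bool) (s : Symbol) : 0 ≤ bec ε b s := by
  cases s with
  | none => exact hε0
  | some b' =>
    simp only [bec]
    split_ifs <;> linarith

lemma sum_bec (ε : ℝ) (b : Bool) : ∑ s, bec ε b s = 1 := by
  rw [Fintype.sum_option]
  cases b <;> simp [bec]

variable {ι β : Type*} [Fintype ι]

lemma prod_bec_mul_ite_nonneg {ε : ℝ} (hε0 : 0 ≤ ε) (hε1 : ε ≤ 1) (c : ι → Bool)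
    (y : ι → Symbol) (p : Prop) [Decidable p] :
    0 ≤ (∏ a, bec ε (c a) (y a)) * if p then 0 else 1 :=
  mul_nonneg (Finset.prod_nonneg fun a _ => bec_nonneg hε0 hε1 _ _) (by split_ifs <;> norm_num)

variable [DecidableEq ι]

/-- The received words in which all symbols at the positions in `D` are erased. -/
def erasedOn (D : Finset ι) : Finset (ι → Symbol) :=
  Fintype.piFinset fun a => if a ∈ D then {none} else univ

@[simp]
lemma mem_erasedOn {D : Finset ι} {y : ι → Symbol} : y ∈ erasedOn D ↔ ∀ a ∈ D, y a = none := by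
  rw [erasedOn, Fintype.mem_piFinset]
  refine forall_congr' fun a => ?_
  split_ifs with ha <;> simp [ha]

lemma sum_erasedOn_prod_bec (ε : ℝ) (D : Finset ι) (c : ι → Bool) :
    ∑ y ∈ erasedOn D, ∏ a, bec ε (c a) (y a) = ε ^ #D := by
  have hfactor (a : ι) :
      ∑ s ∈ (if a ∈ D then {none} else univ), bec ε (c a) s = if a ∈ D then ε else 1 := by
    split_ifs
    · simp [bec]
    · exact sum_bec ε (c a)
  simp [erasedOn, ← Finset.prod_univ_sum, hfactor]

lemma pow_card_le_sum_bec_of_forall_ne [DecidableEq β] {ε : ℝ} (hε0 : 0 ≤ ε) (hε1 : ε ≤ 1)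
    (c : ι → Bool) (dec : (ι → Symbol) → β) (x : β) {D : Finset ι}
    (hne : ∀ y ∈ erasedOn D, dec y ≠ x) :
    ε ^ #D ≤ ∑ y, (∏ a, bec ε (c a) (y a)) * if dec y = x then 0 else 1 := by
  calc ε ^ #D = ∑ y ∈ erasedOn D, ∏ a, bec ε (c a) (y a) := (sum_erasedOn_prod_bec ε D c).symm
    _ = ∑ y ∈ erasedOn D, (∏ a, bec ε (c a) (y a)) * if dec y = x then 0 else 1 :=
      Finset.sum_congr rfl fun y hy => by rw [if_neg (hne y hy), mul_one]
    _ ≤ ∑ y, (∏ a, bec ε (c a) (y a)) * if dec y = x then 0 else 1 :=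
      Finset.sum_le_univ_sum_of_nonneg fun y => prod_bec_mul_ite_nonneg hε0 hε1 c y _

variable {n k : ℕ}

lemma card_div_mul_pow_card_le_blockErrorProb {ε : ℝ} (hε0 : 0 ≤ ε) (hε1 : ε ≤ 1)
    (enc : (Fin k → Bool) → (Fin n → Bool)) {dec : (Fin n → Symbol) → (Fin k → Bool)}
    {D : Finset (Fin n)} {X : Finset (Fin k → Bool)} (hX : ∀ y ∈ erasedOn D, dec y ∉ X) :
    #X / 2 ^ k * ε ^ #D ≤ blockErrorProb ε enc dec := by
  calc #X / 2 ^ k * ε ^ #D = ∑ _x ∈ X, (1 / 2 : ℝ) ^ k * ε ^ #D := by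
        rw [Finset.sum_const, nsmul_eq_mul, one_div_pow]
        ring
    _ ≤ ∑ x ∈ X, (1 / 2 : ℝ) ^ k *
          ∑ y, (∏ a, bec ε (enc x a) (y a)) * if dec y = x then 0 else 1 := by
        gcongr with x hx
        exact pow_card_le_sum_bec_of_forall_ne hε0 hε1 _ _ _ fun y hy =>
          (ne_of_mem_of_not_mem hx (hX y hy)).symm
    _ ≤ blockErrorProb ε enc dec :=
        Finset.sum_le_univ_sum_of_nonneg fun x => mul_nonneg (by positivity)
          (Finset.sum_nonneg fun y _ => prod_bec_mul_ite_nonneg hε0 hε1 (enc x) y _)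

lemma two_pow_le_two_mul_card_filter_restrict_notMem {W : Finset (Fin k)}
    {G : Finset (W → Bool)} (hG : 2 * #G ≤ 2 ^ #W) :
    2 ^ k ≤ 2 * #{x : Fin k → Bool | W.restrict x ∉ G} := by
  have hhit : 2 * #{x : Fin k → Bool | W.restrict x ∈ G} ≤ 2 ^ k := by
    calc 2 * #{x : Fin k → Bool | W.restrict x ∈ G} = 2 * #G * 2 ^ #Wᶜ := by
          rw [card_filter_restrict_mem, Fintype.card_bool, mul_assoc]
      _ ≤ 2 ^ #W * 2 ^ #Wᶜ := by gcongr
      _ = 2 ^ k := by rw [← pow_add, Finset.card_add_card_compl, Fintype.card_fin]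
  have hsplit := Finset.card_filter_add_card_filter_not (s := univ)
    fun x : Fin k → Bool => W.restrict x ∈ G
  simp only [Finset.card_univ, Fintype.card_fun, Fintype.card_bool, Fintype.card_fin] at hsplit
  omega

lemma half_mul_pow_card_le_blockErrorProb {ε : ℝ} (hε0 : 0 ≤ ε) (hε1 : ε ≤ 1)
    (enc : (Fin k → Bool) → (Fin n → Bool)) {dec : (Fin n → Symbol) → (Fin k → Bool)}
    {D : Finset (Fin n)} {W : Finset (Fin k)}
    (hfew : 2 * #((erasedOn D).image fun y => W.restrict (dec y)) ≤ 2 ^ #W) :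
    1 / 2 * ε ^ #D ≤ blockErrorProb ε enc dec := by
  set missed : Finset (Fin k → Bool) :=
    {x | W.restrict x ∉ (erasedOn D).image fun y => W.restrict (dec y)}
  have hhalf : (1 / 2 : ℝ) ≤ #missed / 2 ^ k := by
    rw [div_le_div_iff₀ two_pos (by positivity), one_mul, mul_comm]
    exact_mod_cast two_pow_le_two_mul_card_filter_restrict_notMem hfew
  calc 1 / 2 * ε ^ #D ≤ #missed / 2 ^ k * ε ^ #D := by gcongr
    _ ≤ blockErrorProb ε enc dec :=
      card_div_mul_pow_card_le_blockErrorProb hε0 hε1 enc fun y hy hmissed =>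
        (Finset.mem_filter_univ _).1 hmissed (Finset.mem_image_of_mem _ hy)

end ErrorProbability

namespace Circuit

variable {m n k : ℕ} (C : Circuit m n k)

/-- The positions of the channel symbols injected in the cycles `s, …, t - 1`. -/
abbrev inputsDuring (s t : ℕ) : Finset (Fin n) := eventsDuring (fun a => (C.inTime a : ℕ)) s t

/-- The positions of the bits put out in the cycles `s, …, t - 1`. -/
abbrev outputsDuring (s t : ℕ) : Finset (Fin k) := eventsDuring (fun b => (C.outTime b : ℕ)) s t

lemma inputsDuring_zero_T : C.inputsDuring 0 C.T = univ :=
  eventsDuring_zero_of_forall_lt fun a => (C.inTime a).isLt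

lemma outputsDuring_zero_T : C.outputsDuring 0 C.T = univ :=
  eventsDuring_zero_of_forall_lt fun b => (C.outTime b).isLt

lemma injected_congr {y y' : Fin n → Symbol} {t : ℕ}
    (h : ∀ a, (C.inTime a : ℕ) = t → y a = y' a) (v : C.Node) :
    C.injected y v t = C.injected y' v t := by
  refine Option.map_congr fun a ha => h a ?_
  have hfound := List.find?_some (Option.mem_def.1 ha)
  exact (of_decide_eq_true hfound).2

lemma fire_congr {y y' : Fin n → Symbol} {t : ℕ} (h : ∀ a, (C.inTime a : ℕ) = t → y a = y' a)
    (σ : C.State) (v : C.Node) : C.fire y σ t v = C.fire y' σ t v := by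
  rw [fire, fire, C.injected_congr h]

lemma stateAt_congr {y y' : Fin n → Symbol} {s t : ℕ} (hst : s ≤ t)
    (h : ∀ a ∈ C.inputsDuring s t, y a = y' a) (hs : C.stateAt y s = C.stateAt y' s) :
    C.stateAt y t = C.stateAt y' t := by
  induction t, hst using Nat.le_induction with
  | base => exact hs
  | succ t hst ih =>
    have hstate := ih fun a ha => h a (by grind [mem_eventsDuring])
    have hfire := C.fire_congr (y := y) (y' := y') (t := t)
      fun a ha => h a (by grind [mem_eventsDuring])
    funext v
    simp only [stateAt, hstate, hfire]

lemma decode_congr {y y' : Fin n → Symbol} {s t : ℕ} (h : ∀ a ∈ C.inputsDuring s t, y a = y' a)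
    (hs : C.stateAt y s = C.stateAt y' s) {b : Fin k} (hb : b ∈ C.outputsDuring s t) :
    C.decode y b = C.decode y' b := by
  obtain ⟨hsb, hbt⟩ := mem_eventsDuring.1 hb
  have hstate := C.stateAt_congr hsb (fun a ha => h a (by grind [mem_eventsDuring])) hs
  have hfire := C.fire_congr (y := y) (y' := y') (t := C.outTime b)
    fun a ha => h a (by grind [mem_eventsDuring])
  rw [decode, decode, hstate, hfire]

lemma card_image_restrict_decode_le (s t : ℕ) :
    #((erasedOn (C.inputsDuring s t)).image fun y => (C.outputsDuring s t).restrict (C.decode y)) ≤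
      #(univ.image fun y => C.stateAt y s) := by
  refine (card_image_le_card_image_of_factors fun y hy y' hy' hs => ?_).trans
    (Finset.card_le_card (Finset.image_subset_image (Finset.subset_univ _)))
  funext b
  rw [mem_erasedOn] at hy hy'
  exact C.decode_congr (fun a ha => by rw [hy a ha, hy' a ha]) hs b.2

lemma card_state : Fintype.card C.State = 2 ^ ((4 + m) * #C.nodes) := by
  have hDir : Fintype.card Dir = 4 := rfl
  simp only [State, Layout.Node, Fintype.card_fun, Fintype.card_prod, Fintype.card_bool,
    Fintype.card_fin, hDir, Fintype.card_coe, ← pow_add, ← pow_mul]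

lemma card_outputs_at_le (t : ℕ) : #{b | (C.outTime b : ℕ) = t} ≤ #C.nodes := by
  have hinj : Set.InjOn C.outNode ({b | (C.outTime b : ℕ) = t} : Finset (Fin k)) :=
    fun b hb b' hb' h => C.out_inj <| Prod.ext h <| Fin.ext <| by
      simp only [Finset.coe_filter_univ, Set.mem_ofPred_eq] at hb hb'
      rw [hb, hb']
  simpa using Finset.card_le_card_of_injOn C.outNode (fun _ _ => Finset.mem_univ _) hinj

lemma le_numOutputNodes_mul_T : k ≤ C.numOutputNodes * C.T := by
  simpa [numOutputNodes] using Finset.card_le_card_of_injOn (s := univ)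
    (t := univ.image C.outNode ×ˢ (univ : Finset (Fin C.T)))
    (fun b => (C.outNode b, C.outTime b)) (fun b _ => by simp) C.out_inj.injOn

variable {C} in
lemma card_nodes_pos (hk : 0 < k) : 0 < #C.nodes :=
  Finset.card_pos.2 ⟨_, (C.outNode ⟨0, hk⟩).2⟩

lemma half_mul_pow_card_inputsDuring_le {ε : ℝ} (hε0 : 0 ≤ ε) (hε1 : ε ≤ 1)
    (enc : (Fin k → Bool) → (Fin n → Bool)) {s t : ℕ}
    (hfew : 2 * #(univ.image fun y => C.stateAt y s) ≤ 2 ^ #(C.outputsDuring s t)) :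
    1 / 2 * ε ^ #(C.inputsDuring s t) ≤ blockErrorProb ε enc C.decode :=
  half_mul_pow_card_le_blockErrorProb hε0 hε1 enc <|
    (Nat.mul_le_mul_left 2 (C.card_image_restrict_decode_le s t)).trans hfew

lemma exists_two_mul_card_stateAt_le (hk : 0 < k) :
    ∃ s t, 2 * #(univ.image fun y => C.stateAt y s) ≤ 2 ^ #(C.outputsDuring s t) ∧
      #(C.inputsDuring s t) * k ≤ 2 * ((6 + m) * C.area) * n := by
  have hnodes : 0 < #C.nodes := card_nodes_pos hk
  have harea : #C.nodes ≤ C.area := Nat.le_add_right _ _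
  have hM : (4 + m) * #C.nodes + 1 + #C.nodes ≤ (6 + m) * C.area := by nlinarith
  rcases le_or_gt ((4 + m) * #C.nodes + 1 + #C.nodes) k with hlarge | hsmall
  · obtain ⟨s, t, hout, hin⟩ := exists_card_eventsDuring_mul_card_le
      (fun a => (C.inTime a : ℕ)) (Nat.succ_pos _) C.card_outputs_at_le
      (by rwa [Fintype.card_fin])
    rw [Fintype.card_fin, Fintype.card_fin] at hin
    refine ⟨s, t, ?_, hin.trans (by gcongr)⟩
    calc 2 * #(univ.image fun y => C.stateAt y s) ≤ 2 * 2 ^ ((4 + m) * #C.nodes) := by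
          rw [← C.card_state]
          gcongr
          exact Finset.card_le_univ _
      _ = 2 ^ ((4 + m) * #C.nodes + 1) := by ring
      _ ≤ 2 ^ #(C.outputsDuring s t) := Nat.pow_le_pow_right two_pos hout
  -- With fewer bits than a window needs, the whole run serves: it begins in the state `C.init`.
  · refine ⟨0, C.T, ?_, ?_⟩
    · have hinit : #(univ.image fun y => C.stateAt y 0) ≤ 1 := by
        rw [Finset.card_le_one]
        simp [stateAt]
      rw [outputsDuring_zero_T, Finset.card_univ, Fintype.card_fin]
      exact (Nat.mul_le_mul_left 2 hinit).trans (Nat.le_self_pow hk.ne' 2)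
    · rw [inputsDuring_zero_T, Finset.card_univ, Fintype.card_fin, mul_comm]
      exact Nat.mul_le_mul_right n (by omega)

lemma neg_log_le_mul_area (hk : 0 < k) {ε p : ℝ} (hε0 : 0 < ε) (hε1 : ε ≤ 1)
    {enc : (Fin k → Bool) → (Fin n → Bool)} (hp : blockErrorProb ε enc C.decode ≤ p) :
    -Real.log p ≤ (Real.log 2 + 2 * (6 + m) * (n / k) * -Real.log ε) * C.area := by
  obtain ⟨s, t, hfew, hd⟩ := C.exists_two_mul_card_stateAt_le hk
  have hlog := Real.log_le_log (by positivity)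
    ((C.half_mul_pow_card_inputsDuring_le hε0.le hε1 enc hfew).trans hp)
  generalize #(C.inputsDuring s t) = d at hd hlog
  rw [Real.log_mul (by norm_num) (by positivity), Real.log_pow, one_div, Real.log_inv] at hlog
  have hL : 0 ≤ -Real.log ε := neg_nonneg.2 (Real.log_nonpos hε0.le hε1)
  have hA : (1 : ℝ) ≤ C.area := by
    exact_mod_cast (card_nodes_pos hk).trans_le (Nat.le_add_right _ _)
  have hd' : (d : ℝ) ≤ 2 * (6 + m) * (n / k) * C.area := by
    have hk' : (0 : ℝ) < k := by exact_mod_cast hk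
    rw [mul_div_assoc', div_mul_eq_mul_div, le_div_iff₀ hk']
    calc (d : ℝ) * k ≤ 2 * ((6 + m) * C.area) * n := by exact_mod_cast hd
      _ = 2 * (6 + m) * n * C.area := by ring
  calc -Real.log p ≤ Real.log 2 * 1 + d * -Real.log ε := by linarith
    _ ≤ Real.log 2 * C.area + 2 * (6 + m) * (n / k) * C.area * -Real.log ε := by gcongr
    _ = (Real.log 2 + 2 * (6 + m) * (n / k) * -Real.log ε) * C.area := by ring

lemma mul_neg_log_le_numOutputNodes_mul_energy (hn : 0 < n) {ε ρ p : ℝ} (hε0 : 0 < ε)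
    (hε1 : ε ≤ 1) (hρ : 0 < ρ) (hk : ρ * n ≤ k) {enc : (Fin k → Bool) → (Fin n → Bool)}
    (hp : blockErrorProb ε enc C.decode ≤ p) :
    ρ * (n * -Real.log p) ≤
      (Real.log 2 + 2 * (6 + m) * ρ⁻¹ * -Real.log ε) * (C.numOutputNodes * C.energy) := by
  have hn' : (0 : ℝ) < n := by exact_mod_cast hn
  have hk0 : (0 : ℝ) < k := (mul_pos hρ hn').trans_le hk
  have hL : 0 ≤ -Real.log ε := neg_nonneg.2 (Real.log_nonpos hε0.le hε1)
  have hnk : (n / k : ℝ) ≤ ρ⁻¹ := by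
    rwa [div_le_iff₀ hk0, ← div_eq_inv_mul, le_div_iff₀' hρ]
  set K : ℝ := Real.log 2 + 2 * (6 + m) * ρ⁻¹ * -Real.log ε with hK_def
  have hK : 0 ≤ K := add_nonneg (Real.log_nonneg one_le_two) (by positivity)
  have harea : -Real.log p ≤ K * C.area :=
    (C.neg_log_le_mul_area (by exact_mod_cast hk0) hε0 hε1 hp).trans (by rw [hK_def]; gcongr)
  have htime : ρ * n ≤ C.numOutputNodes * C.T :=
    hk.trans (by exact_mod_cast C.le_numOutputNodes_mul_T)
  calc ρ * (n * -Real.log p) = ρ * n * -Real.log p := by ring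
    _ ≤ ρ * n * (K * C.area) := by gcongr
    _ ≤ C.numOutputNodes * C.T * (K * C.area) :=
      mul_le_mul_of_nonneg_right htime (mul_nonneg hK (Nat.cast_nonneg _))
    _ = K * (C.numOutputNodes * C.energy) := by rw [energy, Nat.cast_mul]; ring

end Circuit

end Thompson

theorem mainTheorem6_general (m : ℕ) (ε : ℝ) (hε0 : 0 < ε) (hε1 : ε ≤ 1) (f : ℕ → ℝ)
    (S : Thompson.DecodingScheme m) (hrate : S.HasPositiveRate) (hf : S.IsFDecoding ε f) :
    ∃ c : ℝ, 0 < c ∧ ∀ᶠ i in Filter.atTop,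
      c * ((S.n i : ℝ) * (-Real.log (f (S.n i)))) ≤
        ((S.dec i).numOutputNodes : ℝ) * ((S.dec i).energy : ℝ) := by
  obtain ⟨ρ, hρ, hrate⟩ := hrate
  have hL : 0 ≤ -Real.log ε := neg_nonneg.2 (Real.log_nonpos hε0.le hε1)
  have hK : 0 < Real.log 2 + 2 * (6 + m) * ρ⁻¹ * -Real.log ε :=
    add_pos_of_pos_of_nonneg (Real.log_pos one_lt_two) (by positivity)
  refine ⟨ρ / (Real.log 2 + 2 * (6 + m) * ρ⁻¹ * -Real.log ε), div_pos hρ hK, ?_⟩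
  filter_upwards [hrate, hf, Filter.eventually_gt_atTop 0] with i hk herror hi
  rw [div_mul_eq_mul_div, div_le_iff₀' hK]
  exact (S.dec i).mul_neg_log_le_numOutputNodes_mul_energy
    (hi.trans_le S.n_strictMono.le_apply) hε0 hε1 hρ hk herror.le

theorem mainTheorem6 (m : ℕ) (ε : ℝ) (hε0 : 0 < ε) (hε1 : ε ≤ 1) (f : ℕ → ℝ)
    (S : Thompson.DecodingScheme m) (hrate : S.HasPositiveRate) (hserial : S.IsSerial)
    (hf : S.IsFDecoding ε f) :
    ∃ c : ℝ, 0 < c ∧ ∀ᶠ i in Filter.atTop,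
      c * ((S.n i : ℝ) * (-Real.log (f (S.n i)))) ≤ ((S.dec i).energy : ℝ) := by
  obtain ⟨j, hj⟩ := hserial
  obtain ⟨c, hc, h⟩ := mainTheorem6_general m ε hε0 hε1 f S hrate hf
  refine ⟨c / (j + 1), by positivity, h.mono fun i hi => ?_⟩
  rw [div_mul_eq_mul_div, div_le_iff₀' (by positivity)]
  exact (hj i ▸ hi).trans (by gcongr; exact le_add_of_nonneg_right zero_le_one)
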